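/- Let $k\ge 0$ be an integer. A function $\ell:\mathbb{R}^k\times\mathbb{R}^k\to\mathbb{R}$ is said to satisfy the Schoenberg condition if, for every integer $n\ge 2$ and all $z_1,\dots,z_n\in\mathbb{R}^k$, the matrix $JLJ$ is (symmetric and) positive semidefinite, where $L=(\ell(z_i,z_j))_{i,j=1}^n$, $J=I_n-\frac1n 1_n1_n^\top$ and $1_n\in\mathbb{R}^n$ is the all-ones vector. The Schoenberg condition holds in each of the following cases: 1. $\ell$ is a positive semidefinite kernel on $\mathbb{R}^k\times\mathbb{R}^k$, that is, $\ell(x,y)=\ell(y,x)$ for all $x,y$, and $\sum_{i=1}^m\sum_{j=1}^m c_ic_j\,\ell(x_i,x_j)\ge 0$ for all $m\ge 0$, $x_1,\dots,x_m\in\mathbb{R}^k$ and $c_1,\dots,c_m\in\mathbb{R}$. 2. $\ell(x,y)=-\|x-y\|_p^q$ for some real $p\in(0,2]$ and $q\in(0,p]$, where $\|x\|_p=\big(\sum_{i=1}^k|x_i|^p\big)^{1/p}$ (which is not a norm when $p<1$ and $k\ge2$). -/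

import Mathlib

/-- A real positive semidefinite kernel on a set `E`: a symmetric function `ℓ : E × E → ℝ` with
`∑ᵢ ∑ⱼ cᵢ cⱼ ℓ(xᵢ, xⱼ) ≥ 0` for all finite families of points `xᵢ` and of real numbers `cᵢ`. -/
def IsPosSemidefKernel {E : Type*} (ℓ : E → E → ℝ) : Prop :=
  (∀ x y, ℓ x y = ℓ y x) ∧
    ∀ (n : ℕ) (x : Fin n → E) (c : Fin n → ℝ),
      0 ≤ ∑ i, ∑ j, c i * c j * ℓ (x i) (x j)

/-- The centering matrix `J = Iₙ - (1/n) 1ₙ 1ₙᵀ`, where `1ₙ` is the all-ones vector. -/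
noncomputable def centeringMatrix (n : ℕ) : Matrix (Fin n) (Fin n) ℝ :=
  1 - (1 / (n : ℝ)) • Matrix.vecMulVec (fun _ => (1 : ℝ)) (fun _ => (1 : ℝ))

/-- The matrix `L = (ℓ(zᵢ, zⱼ))`. -/
def kernelMatrix {E : Type*} (ℓ : E → E → ℝ) {n : ℕ} (z : Fin n → E) :
    Matrix (Fin n) (Fin n) ℝ :=
  Matrix.of fun i j => ℓ (z i) (z j)

/-- The Schoenberg condition: `J L J` is positive semidefinite for all finite families of
`n ≥ 2` points (`Matrix.PosSemidef` includes the symmetry of the matrix). -/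
def SchoenbergCondition {E : Type*} (ℓ : E → E → ℝ) : Prop :=
  ∀ (n : ℕ), 2 ≤ n → ∀ z : Fin n → E,
    (centeringMatrix n * kernelMatrix ℓ z * centeringMatrix n).PosSemidef

/-- The `p`-norm of a vector in `ℝᵏ`, for a real `p > 0` (in general not a norm when `p < 1`). -/
noncomputable def pNorm {k : ℕ} (p : ℝ) (x : Fin k → ℝ) : ℝ :=
  ‖WithLp.toLp (ENNReal.ofReal p) x‖

theorem pNorm_eq {k : ℕ} {p : ℝ} (hp : 0 < p) (x : Fin k → ℝ) :
    pNorm p x = (∑ i, |x i| ^ p) ^ (1 / p) := by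
  have h : (ENNReal.ofReal p).toReal = p := ENNReal.toReal_ofReal hp.le
  unfold pNorm
  rw [PiLp.norm_eq_sum (by rw [h]; exact hp), h]
  simp [Real.norm_eq_abs]

open Matrix MeasureTheory Set

namespace Matrix

variable {ι : Type*} [Fintype ι]

/-! Since `J` is symmetric with range in the vectors of sum zero, it suffices that the form of `ℓ`
is nonnegative on such vectors. This settles psd kernels; for the second case, `‖x - y‖_p ^ q = (∑
|x_a - y_a| ^ p) ^ (q / p)` is built from the kernels `(x_a - y_a) ^ 2` by powers in `(0, 1]` and
sums, which preserve conditional negativity (`IsCondNegSemidef.map_rpow`). Powers are integrals of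
`1/t - 1/(t + D)`, and `1/(t + D)` is a Laplace integral of `exp (-s D)`, psd by Schoenberg's
theorem. -/

theorem dotProduct_mulVec_eq_sum_sum (A : Matrix ι ι ℝ) (c : ι → ℝ) :
    c ⬝ᵥ (A *ᵥ c) = ∑ i, ∑ j, c i * c j * A i j := by
  simp only [dotProduct, mulVec, Finset.mul_sum]
  exact Finset.sum_congr rfl fun i _ => Finset.sum_congr rfl fun j _ => by ring

theorem posSemidef_iff_sum_sum_nonneg (A : Matrix ι ι ℝ) :
    A.PosSemidef ↔ A.IsSymm ∧ ∀ c : ι → ℝ, 0 ≤ ∑ i, ∑ j, c i * c j * A i j := by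
  rw [posSemidef_iff_dotProduct_mulVec]
  simp [← dotProduct_mulVec_eq_sum_sum, IsHermitian, IsSymm, conjTranspose_eq_transpose_of_trivial]

/-- Entrywise powers of a positive semidefinite real matrix are positive semidefinite. -/
theorem PosSemidef.map_pow {A : Matrix ι ι ℝ} (hA : A.PosSemidef) (n : ℕ) :
    (A.map (· ^ n)).PosSemidef := by
  induction n with
  | zero =>
    have h : A.map (· ^ 0) = vecMulVec (fun _ => 1) (star fun _ => 1) := by
      ext i j; simp [vecMulVec]
    rw [h]
    exact posSemidef_vecMulVec_self_star _
  | succ n ih =>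
    have h : A.map (· ^ (n + 1)) = A.map (· ^ n) ⊙ A := by
      ext i j; simp [pow_succ]
    rw [h]
    exact ih.hadamard hA

/-- The entrywise exponential of a positive semidefinite real matrix is positive semidefinite. -/
theorem PosSemidef.map_exp {A : Matrix ι ι ℝ} (hA : A.PosSemidef) :
    (A.map Real.exp).PosSemidef := by
  rw [posSemidef_iff_sum_sum_nonneg]
  refine ⟨((posSemidef_iff_sum_sum_nonneg A).1 hA).1.map _, fun c => ?_⟩
  have h : HasSum (fun n : ℕ => ∑ i, ∑ j, c i * c j * (A i j ^ n / n.factorial))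
      (∑ i, ∑ j, c i * c j * A.map Real.exp i j) := by
    refine hasSum_sum fun i _ => hasSum_sum fun j _ => HasSum.mul_left _ ?_
    rw [map_apply, Real.exp_eq_exp_ℝ]
    exact NormedSpace.expSeries_div_hasSum_exp (A i j)
  refine h.nonneg fun n => ?_
  have hn := ((posSemidef_iff_sum_sum_nonneg _).1 (hA.map_pow n)).2 c
  have e : ∑ i, ∑ j, c i * c j * (A i j ^ n / n.factorial) =
      (∑ i, ∑ j, c i * c j * A.map (· ^ n) i j) / n.factorial := by
    simp only [Finset.sum_div, map_apply, mul_div_assoc]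
  rw [e]
  positivity

/-- A symmetric real matrix whose quadratic form is nonpositive on the vectors with coordinate
sum zero. -/
def IsCondNegSemidef (D : Matrix ι ι ℝ) : Prop :=
  D.IsSymm ∧ ∀ c : ι → ℝ, ∑ i, c i = 0 → ∑ i, ∑ j, c i * c j * D i j ≤ 0

theorem IsCondNegSemidef.sum {κ : Type*} (s : Finset κ) {D : κ → Matrix ι ι ℝ}
    (hD : ∀ a ∈ s, (D a).IsCondNegSemidef) : (∑ a ∈ s, D a).IsCondNegSemidef := by
  refine ⟨?_, fun c hc => ?_⟩
  · rw [IsSymm, transpose_sum]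
    exact Finset.sum_congr rfl fun a ha => (hD a ha).1
  · have e : ∑ i, ∑ j, c i * c j * (∑ a ∈ s, D a) i j =
        ∑ a ∈ s, ∑ i, ∑ j, c i * c j * D a i j := by
      symm
      rw [Finset.sum_comm]
      refine Finset.sum_congr rfl fun i _ => ?_
      rw [Finset.sum_comm]
      exact Finset.sum_congr rfl fun j _ => by rw [sum_apply, Finset.mul_sum]
    rw [e]
    exact Finset.sum_nonpos fun a ha => (hD a ha).2 c hc

/-- When `∑ c = 0` only the cross term survives, giving `-2 (∑ c i * x i) ^ 2`. -/
theorem isCondNegSemidef_sq_sub (x : ι → ℝ) :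
    (of fun i j => (x i - x j) ^ 2).IsCondNegSemidef := by
  refine ⟨by ext i j; simp only [transpose_apply, of_apply]; ring, fun c hc => ?_⟩
  have e : ∑ i, ∑ j, c i * c j * (of fun i j => (x i - x j) ^ 2) i j =
      (∑ i, c i * x i ^ 2) * ∑ j, c j + (∑ i, c i) * ∑ j, c j * x j ^ 2 -
        2 * ((∑ i, c i * x i) * ∑ j, c j * x j) := by
    simp only [Finset.sum_mul_sum]
    simp only [Finset.mul_sum, ← Finset.sum_add_distrib, ← Finset.sum_sub_distrib, of_apply]
    exact Finset.sum_congr rfl fun i _ => Finset.sum_congr rfl fun j _ => by ring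
  rw [e, hc]
  nlinarith [mul_self_nonneg (∑ i, c i * x i)]

/-- Centering a conditionally negative semidefinite matrix at an index gives a positive
semidefinite matrix. -/
theorem IsCondNegSemidef.posSemidef_centered {D : Matrix ι ι ℝ} (hD : D.IsCondNegSemidef)
    (o : ι) : (of fun i j => D i o + D o j - D i j - D o o).PosSemidef := by
  classical
  rw [posSemidef_iff_sum_sum_nonneg]
  refine ⟨?_, fun c => ?_⟩
  · ext i j
    simp only [transpose_apply, of_apply]
    rw [hD.1.apply i j, hD.1.apply o j, hD.1.apply i o]
    ring
  -- Moving mass `-∑ c` to the index `o` makes the sum zero without changing the centered form.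
  · have h := hD.2 (fun i => c i - (∑ k, c k) * if i = o then 1 else 0) (by simp)
    have e : ∑ i, ∑ j, c i * c j * (of fun i j => D i o + D o j - D i j - D o o) i j =
        (∑ i, c i * D i o) * (∑ j, c j) + (∑ i, c i) * (∑ j, c j * D o j)
          - (∑ i, ∑ j, c i * c j * D i j) - (∑ i, c i) * (∑ j, c j) * D o o := by
      simp only [Finset.sum_mul_sum]
      simp only [Finset.sum_mul, ← Finset.sum_add_distrib, ← Finset.sum_sub_distrib, of_apply]
      exact Finset.sum_congr rfl fun i _ => Finset.sum_congr rfl fun j _ => by ring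
    set s := ∑ k, c k with hs
    have e' : ∑ i, ∑ j, (c i - s * if i = o then 1 else 0) *
          (c j - s * if j = o then 1 else 0) * D i j =
        (∑ i, ∑ j, c i * c j * D i j) - s * (∑ i, c i * D i o) - s * (∑ j, c j * D o j)
          + s * s * D o o := by
      simp only [sub_mul, mul_sub, Finset.sum_sub_distrib, mul_ite, ite_mul, mul_one, mul_zero,
        zero_mul, Finset.sum_ite_eq', Finset.mem_univ, if_true, Finset.sum_ite_irrel,
        Finset.sum_const_zero, Finset.mul_sum]
      simp only [mul_assoc, mul_left_comm]
      ring
    rw [e'] at h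
    rw [e]
    linarith

/-- **Schoenberg**: the entrywise exponential of minus a conditionally negative semidefinite
matrix is positive semidefinite. -/
theorem IsCondNegSemidef.posSemidef_exp_neg {D : Matrix ι ι ℝ} (hD : D.IsCondNegSemidef)
    {s : ℝ} (hs : 0 ≤ s) : (of fun i j => Real.exp (-(s * D i j))).PosSemidef := by
  rcases isEmpty_or_nonempty ι with h | ⟨⟨o⟩⟩
  · exact (posSemidef_iff_sum_sum_nonneg _).2 ⟨by ext i; exact h.elim i, by simp⟩
  have hA := ((hD.posSemidef_centered o).smul hs).map_exp
  -- This rank-one factor cancels the terms in `o` that centering added to the exponent.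
  have hB := posSemidef_vecMulVec_self_star fun i => Real.exp (-(s * D i o) + s * D o o / 2)
  refine (congrArg PosSemidef ?_).mpr (hB.hadamard hA)
  ext i j
  simp only [of_apply, hadamard_apply, vecMulVec_apply, star_trivial, map_apply,
    smul_apply, smul_eq_mul, ← Real.exp_add]
  rw [hD.1.apply o j]
  congr 1
  ring

/-- Integrate `exp (-t s) * exp (-s D)`, psd for each `s`, over `s > 0`. -/
theorem IsCondNegSemidef.posSemidef_inv_add {D : Matrix ι ι ℝ} (hD : D.IsCondNegSemidef)
    (h0 : ∀ i j, 0 ≤ D i j) {t : ℝ} (ht : 0 < t) : (of fun i j => (t + D i j)⁻¹).PosSemidef := by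
  rw [posSemidef_iff_sum_sum_nonneg]
  refine ⟨by ext i j; simp only [transpose_apply, of_apply, hD.1.apply], fun c => ?_⟩
  have hneg (i j : ι) : -(t + D i j) < 0 := by linarith [h0 i j]
  have hint (i j : ι) := integrableOn_exp_mul_Ioi (hneg i j) 0
  have e : ∑ i, ∑ j, c i * c j * (of fun i j => (t + D i j)⁻¹) i j =
      ∫ s in Ioi (0 : ℝ), ∑ i, ∑ j, c i * c j * Real.exp (-(t + D i j) * s) := by
    rw [integral_finsetSum _ fun i _ => integrable_finsetSum _ fun j _ => (hint i j).const_mul _]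
    refine Finset.sum_congr rfl fun i _ => ?_
    rw [integral_finsetSum _ fun j _ => (hint i j).const_mul _]
    refine Finset.sum_congr rfl fun j _ => ?_
    rw [integral_const_mul, integral_exp_mul_Ioi (hneg i j)]
    rw [mul_zero, Real.exp_zero, neg_div_neg_eq, one_div, of_apply]
  rw [e]
  refine setIntegral_nonneg measurableSet_Ioi fun s hs => ?_
  have h := ((posSemidef_iff_sum_sum_nonneg _).1 (hD.posSemidef_exp_neg (le_of_lt hs))).2 c
  have e' : ∑ i, ∑ j, c i * c j * Real.exp (-(t + D i j) * s) = Real.exp (-(t * s)) *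
      ∑ i, ∑ j, c i * c j * (of fun i j => Real.exp (-(s * D i j))) i j := by
    simp only [Finset.mul_sum, of_apply]
    refine Finset.sum_congr rfl fun i _ => Finset.sum_congr rfl fun j _ => ?_
    rw [mul_left_comm, ← Real.exp_add]
    ring_nf
  rw [e']
  positivity

/-- Entrywise powers with exponent in `(0, 1]` of a nonnegative conditionally negative
semidefinite matrix are conditionally negative semidefinite. -/
theorem IsCondNegSemidef.map_rpow {D : Matrix ι ι ℝ} (hD : D.IsCondNegSemidef)
    (h0 : ∀ i j, 0 ≤ D i j) {r : ℝ} (hr : 0 < r) (hr1 : r ≤ 1) :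
    (D.map (· ^ r)).IsCondNegSemidef := by
  refine ⟨hD.1.map _, fun c hc => ?_⟩
  -- The integral representation needs `r < 1`.
  rcases hr1.eq_or_lt with rfl | hr1
  · simpa using hD.2 c hc
  have hmem : r ∈ Ioo (0 : ℝ) 1 := ⟨hr, hr1⟩
  have hC := Real.integral_rpowIntegrand₀₁_one_pos hmem
  have hint (i j : ι) := Real.integrableOn_rpowIntegrand₀₁_Ioi hmem (h0 i j)
  have e : (∑ i, ∑ j, c i * c j * D.map (· ^ r) i j) *
        ∫ t in Ioi 0, Real.rpowIntegrand₀₁ r t 1 =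
      ∫ t in Ioi (0 : ℝ), ∑ i, ∑ j, c i * c j * Real.rpowIntegrand₀₁ r t (D i j) := by
    rw [integral_finsetSum _ fun i _ => integrable_finsetSum _ fun j _ => (hint i j).const_mul _,
      Finset.sum_mul]
    refine Finset.sum_congr rfl fun i _ => ?_
    rw [integral_finsetSum _ fun j _ => (hint i j).const_mul _, Finset.sum_mul]
    refine Finset.sum_congr rfl fun j _ => ?_
    rw [integral_const_mul, Real.integral_rpowIntegrand₀₁_eq_rpow_mul_const hmem (h0 i j),
      map_apply, mul_assoc]
  refine nonpos_of_mul_nonpos_left (e.trans_le ?_) hC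
  refine setIntegral_nonpos measurableSet_Ioi fun t ht => ?_
  have ht : 0 < t := ht
  have h := ((posSemidef_iff_sum_sum_nonneg _).1 (hD.posSemidef_inv_add h0 ht)).2 c
  -- The `t⁻¹` part is constant in `i, j`, so `∑ c = 0` kills it.
  have e' : ∑ i, ∑ j, c i * c j * Real.rpowIntegrand₀₁ r t (D i j) =
      t ^ r * (t⁻¹ * ((∑ i, c i) * ∑ j, c j) -
        ∑ i, ∑ j, c i * c j * (of fun i j => (t + D i j)⁻¹) i j) := by
    simp only [Finset.sum_mul_sum]
    simp only [Finset.mul_sum, ← Finset.sum_sub_distrib, of_apply,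
      Real.rpowIntegrand₀₁]
    exact Finset.sum_congr rfl fun i _ => Finset.sum_congr rfl fun j _ => by ring
  rw [e', hc, zero_mul, mul_zero, zero_sub]
  exact mul_nonpos_of_nonneg_of_nonpos (by positivity) (neg_nonpos.2 h)

theorem isCondNegSemidef_abs_sub_rpow (x : ι → ℝ) {p : ℝ} (hp : 0 < p) (hp2 : p ≤ 2) :
    (of fun i j => |x i - x j| ^ p).IsCondNegSemidef := by
  convert (isCondNegSemidef_sq_sub x).map_rpow (fun i j => sq_nonneg _) (half_pos hp)
    (by linarith : p / 2 ≤ 1) using 1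
  ext i j
  rw [map_apply, of_apply, of_apply, ← sq_abs, ← Real.rpow_natCast, ← Real.rpow_mul (abs_nonneg _)]
  congr 1
  push_cast
  ring

end Matrix

theorem isSymm_centeringMatrix (n : ℕ) : (centeringMatrix n).IsSymm := by
  simp [IsSymm, centeringMatrix, transpose_vecMulVec]

theorem sum_centeringMatrix_mulVec {n : ℕ} (hn : n ≠ 0) (c : Fin n → ℝ) :
    ∑ i, (centeringMatrix n *ᵥ c) i = 0 := by
  have hn' : (n : ℝ) ≠ 0 := Nat.cast_ne_zero.2 hn
  simp [centeringMatrix, sub_mulVec, smul_mulVec, vecMulVec_mulVec, dotProduct, hn']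

/-- The form of `J L J` at `c` is that of `L` at `J c`, whose coordinates sum to zero. -/
theorem schoenbergCondition_of_sum_nonneg {E : Type*} {ℓ : E → E → ℝ}
    (hsymm : ∀ x y, ℓ x y = ℓ y x)
    (h : ∀ (n : ℕ) (z : Fin n → E) (c : Fin n → ℝ), ∑ i, c i = 0 →
      0 ≤ ∑ i, ∑ j, c i * c j * ℓ (z i) (z j)) : SchoenbergCondition ℓ := by
  intro n hn z
  have hJ := isSymm_centeringMatrix n
  have hL : (kernelMatrix ℓ z).IsSymm := by
    ext i j
    exact hsymm _ _
  rw [posSemidef_iff_sum_sum_nonneg]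
  refine ⟨?_, fun c => ?_⟩
  · rw [IsSymm, transpose_mul, transpose_mul, hJ.eq, hL.eq, mul_assoc]
  · have e : c ⬝ᵥ ((centeringMatrix n * kernelMatrix ℓ z * centeringMatrix n) *ᵥ c) =
        (centeringMatrix n *ᵥ c) ⬝ᵥ (kernelMatrix ℓ z *ᵥ (centeringMatrix n *ᵥ c)) := by
      rw [← mulVec_mulVec, ← mulVec_mulVec, dotProduct_mulVec, ← mulVec_transpose, hJ.eq]
    rw [← dotProduct_mulVec_eq_sum_sum, e, dotProduct_mulVec_eq_sum_sum]
    exact h n z _ (sum_centeringMatrix_mulVec (by omega) c)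

theorem IsPosSemidefKernel.schoenbergCondition {E : Type*} {ℓ : E → E → ℝ}
    (hℓ : IsPosSemidefKernel ℓ) : SchoenbergCondition ℓ :=
  schoenbergCondition_of_sum_nonneg hℓ.1 fun n z c _ => hℓ.2 n z c

theorem pNorm_rpow {k : ℕ} {p : ℝ} (hp : 0 < p) (q : ℝ) (x : Fin k → ℝ) :
    pNorm p x ^ q = (∑ a, |x a| ^ p) ^ (q / p) := by
  rw [pNorm_eq hp, ← Real.rpow_mul (Finset.sum_nonneg fun a _ => by positivity)]
  congr 1
  ring

theorem isCondNegSemidef_pNorm_sub_rpow {k : ℕ} {ι : Type*} [Fintype ι] {p q : ℝ} (hp : 0 < p)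
    (hp2 : p ≤ 2) (hq : 0 < q) (hqp : q ≤ p) (z : ι → Fin k → ℝ) :
    (of fun i j => pNorm p (z i - z j) ^ q).IsCondNegSemidef := by
  have h := (IsCondNegSemidef.sum Finset.univ fun a _ =>
    isCondNegSemidef_abs_sub_rpow (fun i => z i a) hp hp2).map_rpow
      (fun i j => by simp only [Matrix.sum_apply, of_apply]; positivity) (div_pos hq hp)
      ((div_le_one hp).2 hqp)
  convert h using 1
  ext i j
  simp only [of_apply, map_apply, Matrix.sum_apply, pNorm_rpow hp, Pi.sub_apply]

theorem schoenbergCondition_neg_pNorm_sub_rpow {k : ℕ} {p q : ℝ} (hp : 0 < p) (hp2 : p ≤ 2)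
    (hq : 0 < q) (hqp : q ≤ p) :
    SchoenbergCondition fun x y : Fin k → ℝ => -(pNorm p (x - y) ^ q) := by
  refine schoenbergCondition_of_sum_nonneg (fun x y => ?_) fun n z c hc => ?_
  · simp only [pNorm_rpow hp, Pi.sub_apply, abs_sub_comm]
  · have h := (isCondNegSemidef_pNorm_sub_rpow hp hp2 hq hqp z).2 c hc
    simpa only [of_apply, mul_neg, Finset.sum_neg_distrib, neg_nonneg] using h

theorem lemma2p1 (k : ℕ) :
    (∀ ℓ : (Fin k → ℝ) → (Fin k → ℝ) → ℝ, IsPosSemidefKernel ℓ → SchoenbergCondition ℓ) ∧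
    (∀ p q : ℝ, 0 < p → p ≤ 2 → 0 < q → q ≤ p →
      SchoenbergCondition fun x y : Fin k → ℝ => -(pNorm p (x - y) ^ q)) :=
  ⟨fun _ hℓ => hℓ.schoenbergCondition,
    fun _ _ hp hp2 hq hqp => schoenbergCondition_neg_pNorm_sub_rpow hp hp2 hq hqp⟩
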